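/- Let $X$ be a compact metric space and let $T:X\to X$ be continuous and surjective; such a pair $(X,T)$ is called a t.d.s. A t.d.s. $(X,T)$ is transitive if for all non-empty open $U,V\subseteq X$ the set $\{n\in\mathbb{Z}_{\ge 0}: U\cap T^{-n}V\neq\emptyset\}$ is infinite, and weakly mixing if $(X\times X,T\times T)$ is transitive. A point $x\in X$ is minimal if the closure $Y$ of its forward orbit $\{x,Tx,T^2x,\dots\}$ is a minimal subsystem, that is, the forward orbit of every $y\in Y$ is dense in $Y$. A t.d.s. is an M-system if it is transitive and its minimal points are dense. Let $K(X)$ be the space of non-empty closed subsets of $X$ with the Hausdorff metric, and let $T_K:K(X)\to K(X)$, $T_K(C)=T(C)$. Then $(X,T)$ is a weakly mixing M-system if and only if $(K(X),T_K)$ is an M-system. -/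

import Mathlib

namespace TopDyn

/-- A topological dynamical system on `X`: a continuous surjective self-map. (In the theorem `X`
is a compact metric space.) -/
structure IsSystem {X : Type*} [TopologicalSpace X] (T : X → X) : Prop where
  continuous : Continuous T
  surjective : Function.Surjective T

/-- The forward orbit `{x, T x, T² x, …}`. -/
def orb {X : Type*} (T : X → X) (x : X) : Set X :=
  Set.range fun n : ℕ => T^[n] x

/-- The set of times `N(U, V) = {n ≥ 0 : U ∩ T⁻ⁿ V ≠ ∅}`. -/
def hittingTimes {X : Type*} (T : X → X) (U V : Set X) : Set ℕ :=
  {n : ℕ | (U ∩ T^[n] ⁻¹' V).Nonempty}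

/-- `N(U, V)` is infinite for all nonempty open `U`, `V`. -/
def IsTransitive {X : Type*} [TopologicalSpace X] (T : X → X) : Prop :=
  ∀ U V : Set X, IsOpen U → IsOpen V → U.Nonempty → V.Nonempty → (hittingTimes T U V).Infinite

/-- `(X × X, T × T)` is transitive. -/
def IsWeaklyMixing {X : Type*} [TopologicalSpace X] (T : X → X) : Prop :=
  IsTransitive (Prod.map T T)

/-- `Y` is a nonempty closed set with `T Y ⊆ Y`, and the orbit of every point of `Y` is dense
in `Y`; that is, `(Y, T)` is a minimal subsystem. -/
structure IsMinimalSubsystem {X : Type*} [TopologicalSpace X] (T : X → X) (Y : Set X) :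
    Prop where
  nonempty : Y.Nonempty
  isClosed : IsClosed Y
  mapsTo : Set.MapsTo T Y Y
  dense_orb : ∀ y ∈ Y, Y ⊆ closure (orb T y)

/-- The orbit closure of `x` is a minimal subsystem. -/
def IsMinimalPoint {X : Type*} [TopologicalSpace X] (T : X → X) (x : X) : Prop :=
  IsMinimalSubsystem T (closure (orb T x))

/-- A transitive system whose minimal points are dense. -/
structure IsMSystem {X : Type*} [TopologicalSpace X] (T : X → X) : Prop where
  isSystem : IsSystem T
  transitive : IsTransitive T
  dense_minimalPoints : Dense {x : X | IsMinimalPoint T x}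

/-- The induced map `T_K : C ↦ T(C)` on the hyperspace of nonempty closed subsets. In a compact
metric space these are the nonempty compact subsets, and Mathlib's metric on `NonemptyCompacts X`
is the Hausdorff metric. -/
def hyperspaceMap {X : Type*} [TopologicalSpace X] (T : X → X) (hT : Continuous T) :
    TopologicalSpace.NonemptyCompacts X → TopologicalSpace.NonemptyCompacts X :=
  TopologicalSpace.NonemptyCompacts.map T hT

end TopDyn

open Set Function TopologicalSpace

namespace TopDyn

/-! ### Orbits and hitting times -/

section Orbits

variable {X Y : Type*} {T : X → X} {S : Y → Y}

/-! Basic Vietoris open sets involve finitely many open sets of `X`, so hitting in the hyperspace is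
simultaneous hitting in `X`, witnessed by finite sets. Weak mixing supplies the common times
(`IsWeaklyMixing.exists_hittingTimes_subset`); conversely, sets inside `U` whose images meet both
`V` and `V'` give weak mixing. Minimal points of powers of `X` map to minimal finite sets under
`rangeCompacts`. Conversely, a minimal subsystem of the membership relation over the orbit closure
of a minimal `C` yields a minimal point in `C`. -/

theorem mem_orb_self (T : X → X) (x : X) : x ∈ orb T x := ⟨0, rfl⟩

theorem mapsTo_orb (T : X → X) (x : X) : MapsTo T (orb T x) (orb T x) := by
  rintro _ ⟨n, rfl⟩
  exact ⟨n + 1, iterate_succ_apply' T n x⟩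

theorem orb_subset {A : Set X} (hA : MapsTo T A A) {x : X} (hx : x ∈ A) : orb T x ⊆ A := by
  rintro _ ⟨n, rfl⟩
  exact hA.iterate n hx

theorem image_orb {π : X → Y} (hπ : Semiconj π T S) (x : X) : π '' orb T x = orb S (π x) := by
  rw [orb, ← range_comp, orb]
  exact congrArg range (funext fun n => (hπ.iterate_right n) x)

theorem hittingTimes_mono {U U' V V' : Set X} (hU : U ⊆ U') (hV : V ⊆ V') :
    hittingTimes T U V ⊆ hittingTimes T U' V' :=
  fun _ ⟨x, hx, hx'⟩ => ⟨x, hU hx, hV hx'⟩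

/-- If `x` witnesses `m` for the first pair, `T^[n] x` does so for the second. -/
theorem hittingTimes_inter_preimage_subset (U U' V V' : Set X) (n : ℕ) :
    hittingTimes T (U ∩ T^[n] ⁻¹' U') (V ∩ T^[n] ⁻¹' V') ⊆
      hittingTimes T U V ∩ hittingTimes T U' V' := by
  rintro m ⟨x, ⟨hx, hx'⟩, hy, hy'⟩
  refine ⟨⟨x, hx, hy⟩, T^[n] x, hx', ?_⟩
  rw [mem_preimage, ← iterate_add_apply, add_comm, iterate_add_apply]
  exact hy'

theorem hittingTimes_prodMap (U U' V V' : Set X) :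
    hittingTimes (Prod.map T T) (U ×ˢ U') (V ×ˢ V') =
      hittingTimes T U V ∩ hittingTimes T U' V' := by
  ext n
  simp only [hittingTimes, Prod.map_iterate, mem_inter_iff, mem_ofPred_eq]
  constructor
  · rintro ⟨⟨x, x'⟩, ⟨hx, hx'⟩, hy, hy'⟩
    exact ⟨⟨x, hx, hy⟩, x', hx', hy'⟩
  · rintro ⟨⟨x, hx, hy⟩, x', hx', hy'⟩
    exact ⟨(x, x'), ⟨hx, hx'⟩, hy, hy'⟩

end Orbits

/-! ### Minimal subsystems and minimal points -/

section Minimal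

variable {X Y : Type*} [TopologicalSpace X] [TopologicalSpace Y] {T : X → X} {S : Y → Y}

theorem IsMinimalSubsystem.closure_orb_eq {M : Set X} (hM : IsMinimalSubsystem T M) {x : X}
    (hx : x ∈ M) : closure (orb T x) = M :=
  (closure_minimal (orb_subset hM.mapsTo hx) hM.isClosed).antisymm (hM.dense_orb x hx)

theorem IsMinimalSubsystem.isMinimalPoint {M : Set X} (hM : IsMinimalSubsystem T M) {x : X}
    (hx : x ∈ M) : IsMinimalPoint T x := by
  rwa [IsMinimalPoint, hM.closure_orb_eq hx]

theorem IsMinimalSubsystem.image [CompactSpace X] [T2Space Y] {M : Set X}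
    (hM : IsMinimalSubsystem T M) {π : X → Y} (hc : Continuous π) (hπ : Semiconj π T S) :
    IsMinimalSubsystem S (π '' M) where
  nonempty := hM.nonempty.image π
  isClosed := (hM.isClosed.isCompact.image hc).isClosed
  mapsTo := by
    rintro _ ⟨x, hx, rfl⟩
    exact ⟨T x, hM.mapsTo hx, hπ x⟩
  dense_orb := by
    rintro _ ⟨x, hx, rfl⟩
    rw [← image_orb hπ]
    exact (image_mono (hM.dense_orb x hx)).trans (image_closure_subset_closure_image hc)

theorem IsMinimalPoint.map [CompactSpace X] [T2Space Y] {x : X} (hx : IsMinimalPoint T x)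
    {π : X → Y} (hc : Continuous π) (hπ : Semiconj π T S) : IsMinimalPoint S (π x) :=
  (hx.image hc hπ).isMinimalPoint (mem_image_of_mem π (subset_closure (mem_orb_self T x)))

theorem exists_isMinimalSubsystem_subset [CompactSpace X] (hT : Continuous T) {Z : Set X}
    (hne : Z.Nonempty) (hcl : IsClosed Z) (hmaps : MapsTo T Z Z) :
    ∃ M ⊆ Z, IsMinimalSubsystem T M := by
  obtain ⟨M, hMZ, hM⟩ := zorn_superset_nonempty
    {A : Set X | A.Nonempty ∧ IsClosed A ∧ MapsTo T A A} (fun c hc hchain hcne => by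
      refine ⟨⋂₀ c, ⟨?_, isClosed_sInter fun A hA => (hc hA).2.1, ?_⟩,
        fun A hA => sInter_subset_of_mem hA⟩
      · have := hcne.to_subtype
        exact IsCompact.nonempty_sInter_of_directed_nonempty_isCompact_isClosed
          (fun A hA B hB => (hchain.total hA hB).elim
            (fun h => ⟨A, hA, subset_rfl, h⟩) fun h => ⟨B, hB, h, subset_rfl⟩)
          (fun A hA => (hc hA).1) (fun A hA => (hc hA).2.1.isCompact)
          (fun A hA => (hc hA).2.1)
      · exact fun x hx A hA => (hc hA).2.2 (hx A hA)) Z ⟨hne, hcl, hmaps⟩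
  refine ⟨M, hMZ, hM.prop.1, hM.prop.2.1, hM.prop.2.2, fun y hy => ?_⟩
  exact hM.le_of_le ⟨⟨y, subset_closure (mem_orb_self T y)⟩, isClosed_closure,
    (mapsTo_orb T y).closure hT⟩ (closure_minimal (orb_subset hM.prop.2.2 hy) hM.prop.2.1)

/-- Density of minimal points passes to powers of a system. -/
theorem exists_isMinimalPoint_pi [CompactSpace X] [T2Space X] (hT : Continuous T)
    (hd : Dense {x | IsMinimalPoint T x}) {ι : Type*} {U : ι → Set X}
    (hU : ∀ i, IsOpen (U i)) (hne : ∀ i, (U i).Nonempty) :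
    ∃ z : ι → X, (∀ i, z i ∈ U i) ∧ IsMinimalPoint (fun w : ι → X => T ∘ w) z := by
  choose x hxU hx using fun i => hd.inter_open_nonempty _ (hU i) (hne i)
  have hcont : Continuous fun w : ι → X => T ∘ w :=
    continuous_pi fun i => hT.comp (continuous_apply i)
  -- The tuple `x` need not be minimal for the product map, so it is replaced by a point of a
  -- minimal set in the product of orbit closures.
  obtain ⟨M, hMZ, hM⟩ := exists_isMinimalSubsystem_subset hcont
    (Z := univ.pi fun i => closure (orb T (x i)))
    ⟨x, fun i _ => subset_closure (mem_orb_self T (x i))⟩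
    (isClosed_set_pi fun i _ => isClosed_closure)
    (fun w hw i hi => (hx i).mapsTo (hw i hi))
  obtain ⟨y, hy⟩ := hM.nonempty
  have key : ∀ i, ∃ n, T^[n] (y i) ∈ U i := fun i => by
    have hxi : x i ∈ closure (orb T (y i)) :=
      (hx i).dense_orb (y i) (hMZ hy i trivial) (subset_closure (mem_orb_self T (x i)))
    obtain ⟨_, hzU, n, rfl⟩ := mem_closure_iff.1 hxi (U i) (hU i) (hxU i)
    exact ⟨n, hzU⟩
  choose n hn using key
  -- Applying a different iterate in each coordinate commutes with the product map, hence preserves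
  -- minimality.
  refine ⟨fun i => T^[n i] (y i), hn, (hM.isMinimalPoint hy).map
    (π := fun w i => T^[n i] (w i))
    (continuous_pi fun i => (hT.iterate (n i)).comp (continuous_apply i)) fun w => ?_⟩
  exact funext fun i => (Function.Commute.refl T).iterate_left (n i) (w i)

end Minimal

/-! ### Weak mixing -/

section Mixing

variable {X : Type*} [TopologicalSpace X] {T : X → X}

theorem isWeaklyMixing_iff : IsWeaklyMixing T ↔ ∀ U U' V V' : Set X, IsOpen U → IsOpen U' →
    IsOpen V → IsOpen V' → U.Nonempty → U'.Nonempty → V.Nonempty → V'.Nonempty →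
      (hittingTimes T U V ∩ hittingTimes T U' V').Infinite := by
  constructor
  · intro h U U' V V' hU hU' hV hV' nU nU' nV nV'
    rw [← hittingTimes_prodMap]
    exact h _ _ (hU.prod hU') (hV.prod hV') (nU.prod nU') (nV.prod nV')
  · rintro h A B hA hB ⟨⟨a, a'⟩, ha⟩ ⟨⟨b, b'⟩, hb⟩
    obtain ⟨U, U', hU, hU', haU, haU', hUA⟩ := isOpen_prod_iff.1 hA a a' ha
    obtain ⟨V, V', hV, hV', hbV, hbV', hVB⟩ := isOpen_prod_iff.1 hB b b' hb
    refine (h U U' V V' hU hU' hV hV' ⟨a, haU⟩ ⟨a', haU'⟩ ⟨b, hbV⟩ ⟨b', hbV'⟩).mono ?_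
    rw [← hittingTimes_prodMap]
    exact hittingTimes_mono hUA hVB

theorem IsWeaklyMixing.isTransitive (h : IsWeaklyMixing T) : IsTransitive T :=
  fun U V hU hV nU nV =>
    (isWeaklyMixing_iff.1 h U U V V hU hU hV hV nU nU nV nV).mono inter_subset_left

/-- Furstenberg's intersection lemma: in a weakly mixing system the sets of hitting times form a
filter base. -/
theorem IsWeaklyMixing.exists_hittingTimes_subset [Nonempty X] (h : IsWeaklyMixing T)
    (hT : Continuous T) {ι : Type*} [Finite ι] {U V : ι → Set X} (hU : ∀ i, IsOpen (U i))
    (hV : ∀ i, IsOpen (V i)) (nU : ∀ i, (U i).Nonempty) (nV : ∀ i, (V i).Nonempty) :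
    ∃ A B : Set X, IsOpen A ∧ IsOpen B ∧ A.Nonempty ∧ B.Nonempty ∧
      ∀ i, hittingTimes T A B ⊆ hittingTimes T (U i) (V i) := by
  classical
  cases nonempty_fintype ι
  suffices H : ∀ s : Finset ι, ∃ A B : Set X, IsOpen A ∧ IsOpen B ∧ A.Nonempty ∧ B.Nonempty ∧
      ∀ i ∈ s, hittingTimes T A B ⊆ hittingTimes T (U i) (V i) by
    simpa using H Finset.univ
  intro s
  induction s using Finset.induction_on with
  | empty => exact ⟨univ, univ, isOpen_univ, isOpen_univ, univ_nonempty, univ_nonempty, by simp⟩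
  | insert i s _ ih =>
    obtain ⟨A, B, hA, hB, nA, nB, hs⟩ := ih
    -- The common time leads from `A` to `U i` and from `B` to `V i`, so the new sources and targets
    -- are nonempty.
    obtain ⟨n, hn, hn'⟩ := (isWeaklyMixing_iff.1 h A B (U i) (V i) hA hB (hU i) (hV i)
      nA nB (nU i) (nV i)).nonempty
    have hsub := hittingTimes_inter_preimage_subset (T := T) A (U i) B (V i) n
    refine ⟨_, _, hA.inter ((hU i).preimage (hT.iterate n)),
      hB.inter ((hV i).preimage (hT.iterate n)), hn, hn', ?_⟩
    simp only [Finset.forall_mem_insert]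
    exact ⟨hsub.trans inter_subset_right,
      fun j hj => (hsub.trans inter_subset_left).trans (hs j hj)⟩

end Mixing

/-! ### The hyperspace system -/

section Hyperspace

variable {X : Type*} [TopologicalSpace X] {T : X → X}

theorem coe_hyperspaceMap_iterate (hT : Continuous T) (n : ℕ) (C : NonemptyCompacts X) :
    (((hyperspaceMap T hT)^[n] C : NonemptyCompacts X) : Set X) = T^[n] '' C := by
  induction n with
  | zero => simp
  | succ n ih =>
    rw [iterate_succ_apply', iterate_succ', image_comp, ← ih]
    rfl

theorem IsSystem.hyperspaceMap [CompactSpace X] [T2Space X] (hT : IsSystem T) :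
    IsSystem (hyperspaceMap T hT.continuous) where
  continuous := hT.continuous.nonemptyCompacts_map
  surjective C := by
    refine ⟨⟨⟨T ⁻¹' C, (C.isCompact.isClosed.preimage hT.continuous).isCompact⟩,
      C.nonempty.preimage hT.surjective⟩, SetLike.coe_injective ?_⟩
    exact image_preimage_eq _ hT.surjective

/-- The nonempty finite set of values of a tuple, as a point of the hyperspace. -/
def rangeCompacts {ι : Type*} [Finite ι] [Nonempty ι] (p : ι → X) : NonemptyCompacts X :=
  ⟨⟨range p, (finite_range p).isCompact⟩, range_nonempty p⟩

theorem continuous_rangeCompacts {ι : Type*} [Finite ι] [Nonempty ι] :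
    Continuous (rangeCompacts : (ι → X) → NonemptyCompacts X) :=
  continuous_induced_rng.2 vietoris.continuous_range_of_finite

theorem hyperspaceMap_rangeCompacts (hT : Continuous T) {ι : Type*} [Finite ι] [Nonempty ι]
    (p : ι → X) : hyperspaceMap T hT (rangeCompacts p) = rangeCompacts (T ∘ p) :=
  SetLike.coe_injective (range_comp T p).symm

/-- A nonempty open set of the hyperspace contains every compact set that is covered by suitable
finitely many nonempty open sets and meets each of them. -/
theorem exists_finite_vietoris_subset {W : Set (NonemptyCompacts X)} (hW : IsOpen W)
    (hne : W.Nonempty) : ∃ u : Set (Set X), u.Finite ∧ u.Nonempty ∧ (∀ U ∈ u, IsOpen U) ∧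
      (∀ U ∈ u, U.Nonempty) ∧
      ∀ K : NonemptyCompacts X, ↑K ⊆ ⋃₀ u → (∀ U ∈ u, (↑K ∩ U).Nonempty) → K ∈ W := by
  obtain ⟨K, hK⟩ := hne
  obtain ⟨_, ⟨u, ⟨hfin, hne, ho⟩, rfl⟩, hKu, hu⟩ :=
    NonemptyCompacts.isTopologicalBasis.exists_subset_of_mem_open hK hW
  exact ⟨u, hfin, hne, ho, fun U hU => (hKu.2 U hU).mono inter_subset_right,
    fun L h₁ h₂ => hu ⟨h₁, h₂⟩⟩

theorem IsWeaklyMixing.isTransitive_hyperspaceMap (h : IsWeaklyMixing T) (hT : Continuous T) :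
    IsTransitive (hyperspaceMap T hT) := by
  intro W W' hW hW' nW nW'
  obtain ⟨u, hu, nu, uo, un, huW⟩ := exists_finite_vietoris_subset hW nW
  obtain ⟨v, hv, nv, vo, vn, hvW⟩ := exists_finite_vietoris_subset hW' nW'
  have := hu.to_subtype
  have := hv.to_subtype
  have := nu.to_subtype
  have := nv.to_subtype
  have : Nonempty X := (un _ nu.some_mem).to_type
  -- One point per pair in `u × v`: the finite set then meets every member of `u`, and its image
  -- every member of `v`.
  obtain ⟨A, B, hA, hB, nA, nB, hAB⟩ := h.exists_hittingTimes_subset hT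
    (ι := u × v) (U := fun i => i.1) (V := fun i => i.2) (fun i => uo _ i.1.2)
    (fun i => vo _ i.2.2) (fun i => un _ i.1.2) (fun i => vn _ i.2.2)
  refine (h.isTransitive A B hA hB nA nB).mono fun n hn => ?_
  choose z hzU hzV using fun i => hAB i hn
  refine ⟨rangeCompacts z, huW _ ?_ fun U hU => ?_, hvW _ ?_ fun V hV => ?_⟩
  · rintro _ ⟨i, rfl⟩
    exact ⟨i.1, i.1.2, hzU i⟩
  · exact ⟨_, ⟨(⟨U, hU⟩, Classical.arbitrary v), rfl⟩, hzU (⟨U, hU⟩, _)⟩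
  · rw [coe_hyperspaceMap_iterate]
    rintro _ ⟨_, ⟨i, rfl⟩, rfl⟩
    exact ⟨i.2, i.2.2, hzV i⟩
  · rw [coe_hyperspaceMap_iterate]
    exact ⟨_, ⟨_, ⟨(Classical.arbitrary u, ⟨V, hV⟩), rfl⟩, rfl⟩, hzV (_, ⟨V, hV⟩)⟩

theorem dense_isMinimalPoint_hyperspaceMap [CompactSpace X] [T2Space X] (hT : Continuous T)
    (hd : Dense {x | IsMinimalPoint T x}) :
    Dense {C | IsMinimalPoint (hyperspaceMap T hT) C} := by
  refine dense_iff_inter_open.2 fun W hW nW => ?_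
  obtain ⟨u, hu, nu, uo, un, huW⟩ := exists_finite_vietoris_subset hW nW
  have := hu.to_subtype
  have := nu.to_subtype
  obtain ⟨z, hz, hzmin⟩ := exists_isMinimalPoint_pi hT hd (U := fun i : u => (i : Set X))
    (fun i => uo _ i.2) (fun i => un _ i.2)
  refine ⟨rangeCompacts z, huW _ ?_ fun U hU => ⟨_, ⟨⟨U, hU⟩, rfl⟩, hz ⟨U, hU⟩⟩,
    hzmin.map continuous_rangeCompacts fun p => (hyperspaceMap_rangeCompacts hT p).symm⟩
  rintro _ ⟨i, rfl⟩
  exact ⟨i, i.2, hz i⟩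

theorem IsTransitive.isWeaklyMixing_of_hyperspaceMap (hT : IsSystem T)
    (h : IsTransitive (hyperspaceMap T hT.continuous)) : IsWeaklyMixing T := by
  have key : ∀ U V V' : Set X, IsOpen U → IsOpen V → IsOpen V' → U.Nonempty → V.Nonempty →
      V'.Nonempty → (hittingTimes T U V ∩ hittingTimes T U V').Infinite := by
    rintro U V V' hU hV hV' ⟨a, ha⟩ ⟨b, hb⟩ ⟨b', hb'⟩
    refine (h {K | ↑K ⊆ U} ({K | (↑K ∩ V).Nonempty} ∩ {K | (↑K ∩ V').Nonempty})
      (NonemptyCompacts.isOpen_subsets_of_isOpen hU)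
      ((NonemptyCompacts.isOpen_inter_nonempty_of_isOpen hV).inter
        (NonemptyCompacts.isOpen_inter_nonempty_of_isOpen hV'))
      ⟨{a}, by simpa using ha⟩
      ⟨{b} ⊔ {b'}, ⟨b, by simp, hb⟩, ⟨b', by simp, hb'⟩⟩).mono ?_
    rintro n ⟨C, hCU, hCV, hCV'⟩
    simp only [mem_ofPred_eq, coe_hyperspaceMap_iterate] at hCU hCV hCV'
    obtain ⟨_, ⟨x, hx, rfl⟩, hxV⟩ := hCV
    obtain ⟨_, ⟨x', hx', rfl⟩, hxV'⟩ := hCV'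
    exact ⟨⟨x, hCU hx, hxV⟩, x', hCU hx', hxV'⟩
  refine isWeaklyMixing_iff.2 fun U U' V V' hU hU' hV hV' nU nU' nV nV' => ?_
  -- Two sources reduce to one: start in `U ∩ T^[n] ⁻¹' U'` and aim at `V` and `T^[n] ⁻¹' V'`, the
  -- latter nonempty by surjectivity.
  obtain ⟨n, hn, -⟩ := (key U U' U' hU hU' hU' nU nU' nU').nonempty
  refine (key (U ∩ T^[n] ⁻¹' U') V (T^[n] ⁻¹' V') (hU.inter (hU'.preimage
    (hT.continuous.iterate n))) hV (hV'.preimage (hT.continuous.iterate n)) hn nV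
    (nV'.preimage (hT.surjective.iterate n))).mono ?_
  rintro m ⟨⟨x, ⟨hx, -⟩, hxV⟩, y, ⟨-, hy⟩, hyV⟩
  refine ⟨⟨x, hx, hxV⟩, T^[n] y, hy, ?_⟩
  rw [mem_preimage, ← iterate_add_apply, add_comm, iterate_add_apply]
  exact hyV

/-- Membership is the closed condition `{x} ⊔ K = K`, as union is continuous. -/
theorem isClosed_setOfPred_mem_nonemptyCompacts [T2Space X] :
    IsClosed {p : NonemptyCompacts X × X | p.2 ∈ p.1} := by
  have : {p : NonemptyCompacts X × X | p.2 ∈ p.1} = {p | {p.2} ⊔ p.1 = p.1} := by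
    ext p
    rw [mem_ofPred_eq, mem_ofPred_eq, sup_eq_right, ← SetLike.coe_subset_coe]
    simp
  rw [this]
  exact isClosed_eq
    ((NonemptyCompacts.continuous_singleton.comp continuous_snd).sup continuous_fst)
    continuous_fst

/-- A minimal point of the hyperspace contains a minimal point of the base. -/
theorem exists_isMinimalPoint_mem [CompactSpace X] [T2Space X] (hT : Continuous T)
    {C : NonemptyCompacts X} (hC : IsMinimalPoint (hyperspaceMap T hT) C) :
    ∃ x ∈ C, IsMinimalPoint T x := by
  obtain ⟨x, hx⟩ := C.nonempty
  have hCmem : C ∈ closure (orb (hyperspaceMap T hT) C) := subset_closure (mem_orb_self _ C)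
  obtain ⟨M, hMZ, hM⟩ := exists_isMinimalSubsystem_subset
    (T := Prod.map (hyperspaceMap T hT) T) (hT.nonemptyCompacts_map.prodMap hT)
    (Z := {p | p.2 ∈ p.1} ∩ Prod.fst ⁻¹' closure (orb (hyperspaceMap T hT) C))
    ⟨(C, x), hx, hCmem⟩
    (isClosed_setOfPred_mem_nonemptyCompacts.inter (isClosed_closure.preimage continuous_fst))
    (fun p hp => ⟨mem_image_of_mem T hp.1, hC.mapsTo hp.2⟩)
  -- This projection lies in the minimal orbit closure of `C`, so it contains `C`; a point of `M`
  -- over `C` is the desired pair.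
  have hfst : IsMinimalSubsystem (hyperspaceMap T hT) (Prod.fst '' M) :=
    hM.image continuous_fst fun _ => rfl
  obtain ⟨p, hp⟩ := hM.nonempty
  have hCM : C ∈ Prod.fst '' M := by
    rw [← hfst.closure_orb_eq (mem_image_of_mem _ hp)]
    exact hC.dense_orb p.1 (hMZ hp).2 hCmem
  obtain ⟨⟨_, y⟩, hq, rfl⟩ := hCM
  exact ⟨y, (hMZ hq).1, (hM.isMinimalPoint hq).map continuous_snd fun _ => rfl⟩

theorem dense_isMinimalPoint_of_hyperspaceMap [CompactSpace X] [T2Space X] (hT : Continuous T)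
    (hd : Dense {C | IsMinimalPoint (hyperspaceMap T hT) C}) :
    Dense {x | IsMinimalPoint T x} := by
  refine dense_iff_inter_open.2 fun U hU ⟨a, ha⟩ => ?_
  obtain ⟨C, hCU, hC⟩ := hd.inter_open_nonempty _ (NonemptyCompacts.isOpen_subsets_of_isOpen hU)
    ⟨{a}, by simpa using ha⟩
  obtain ⟨x, hx, hmin⟩ := exists_isMinimalPoint_mem hT hC
  exact ⟨x, hCU hx, hmin⟩

end Hyperspace

end TopDyn

theorem theorem3p5 {X : Type*} [MetricSpace X] [CompactSpace X]
    (T : X → X) (hT : TopDyn.IsSystem T) :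
    (TopDyn.IsWeaklyMixing T ∧ TopDyn.IsMSystem T) ↔
      TopDyn.IsMSystem (TopDyn.hyperspaceMap T hT.continuous) := by
  constructor
  · rintro ⟨hwm, hM⟩
    exact ⟨hT.hyperspaceMap, hwm.isTransitive_hyperspaceMap hT.continuous,
      TopDyn.dense_isMinimalPoint_hyperspaceMap hT.continuous hM.dense_minimalPoints⟩
  · intro hK
    have hwm := hK.transitive.isWeaklyMixing_of_hyperspaceMap hT
    exact ⟨hwm, hT, hwm.isTransitive,
      TopDyn.dense_isMinimalPoint_of_hyperspaceMap hT.continuous hK.dense_minimalPoints⟩
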